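/- Let $f_1,\dots,f_k\in\mathbb{R}[x_1,\dots,x_n]$ have a nonempty common real zero set $V_{\mathbb R}(f)\subset\mathbb{R}^n$, let $\mathcal{J}$ be the $k\times n$ Jacobian matrix of $f=(f_1,\dots,f_k)^t$, and let $\beta>0$. Let $V_{\mathbb R}(h)\subset\mathbb{R}^{n+k}$ be the real zero set of $h=\{f_1+w_1/\sqrt\beta,\dots,f_k+w_k/\sqrt\beta\}$ in the variables $(x,w)=(x_1,\dots,x_n,w_1,\dots,w_k)$. Then $V_{\mathbb R}(h)$ is a smooth embedded submanifold of $\mathbb{R}^{n+k}$ of dimension $n$, and there is an open set $U'\subset\mathbb{R}^n$ containing $V_{\mathbb R}(f)$ such that: 1. For every $\mathfrak{a}\in U'$ there is a unique point $(x^*,w^*)\in V_{\mathbb R}(h)$ at minimal Euclidean distance from $(\mathfrak{a},0)\in\mathbb{R}^{n+k}$. 2. For every $\mathfrak{a}\in U'$, the component $x^*$ of this point is an isolated simple zero of the square system $x+\beta\,\mathcal{J}(x)^t f(x)=\mathfrak{a}$; that is, it is a solution, no other (even complex) solution lies in some neighbourhood of it, and the Jacobian matrix of the system is nonsingular at $x^*$.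 3. Let $1\le r\le\infty$ and let $\mathfrak{a}:[s,t]\to U'$ be a continuous, piecewise $C^r$ curve (for $r=\infty$: a piecewise smooth curve), and let $(x^*(u),w^*(u))$ be the nearest point on $V_{\mathbb R}(h)$ to $(\mathfrak{a}(u),0)$. Then $u\mapsto(x^*(u),w^*(u))$ is continuous and piecewise $C^r$, and it is obtained by solving the system continuously from any initial point of the curve: for every $u_0\in[s,t]$, $x^*$ is the only continuous $y:[s,t]\to\mathbb{R}^n$ with $y(u)+\beta\,\mathcal{J}(y(u))^t f(y(u))=\mathfrak{a}(u)$ for all $u\in[s,t]$ and $y(u_0)=x^*(u_0)$. -/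

import Mathlib

open scoped ContDiff

noncomputable section

namespace CompanionCurve

/-- The real zero set `V_ℝ(f)` of a family of real polynomials, in Euclidean space. -/
def realZeros {σ ι : Type*} (f : ι → MvPolynomial σ ℝ) : Set (EuclideanSpace ℝ σ) :=
  {x | ∀ i, MvPolynomial.eval (fun j => x j) (f i) = 0}

/-- The system `h = {f₁ + w₁/√β, …, f_k + w_k/√β}` in the variables `x₁, …, xₙ` (left summand)
and `w₁, …, w_k` (right summand). -/
def slackSystem {n k : ℕ} (f : Fin k → MvPolynomial (Fin n) ℝ) (β : ℝ) :
    Fin k → MvPolynomial (Fin n ⊕ Fin k) ℝ :=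
  fun i => MvPolynomial.rename Sum.inl (f i)
    + MvPolynomial.C (1 / √β) * MvPolynomial.X (Sum.inr i)

/-- The square polynomial system `x + β Jᵗ f - a`, where `J` is the Jacobian of `f`. -/
def penaltySystem {n k : ℕ} (f : Fin k → MvPolynomial (Fin n) ℝ) (β : ℝ)
    (a : EuclideanSpace ℝ (Fin n)) : Fin n → MvPolynomial (Fin n) ℝ :=
  fun j => MvPolynomial.X j
    + MvPolynomial.C β * ∑ i, MvPolynomial.pderiv j (f i) * f i
    - MvPolynomial.C (a j)

/-- The Jacobian matrix of a polynomial system at a real point. -/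
def jacobianAt {σ ι : Type*} (F : ι → MvPolynomial σ ℝ) (x : EuclideanSpace ℝ σ) :
    Matrix ι σ ℝ :=
  Matrix.of fun i j => MvPolynomial.eval (fun l => x l) (MvPolynomial.pderiv j (F i))

/-- `x` is an isolated simple zero of the square system `F`: it is a zero, no other complex
(in particular no other real) zero lies close to it, and the Jacobian of `F` is nonsingular
there. -/
structure IsIsolatedSimpleZero {n : ℕ} (F : Fin n → MvPolynomial (Fin n) ℝ)
    (x : EuclideanSpace ℝ (Fin n)) : Prop where
  zero : x ∈ realZeros F
  isolated : ∃ ε : ℝ, 0 < ε ∧ ∀ z : Fin n → ℂ, (∀ j, ‖z j - (x j : ℂ)‖ < ε) →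
    (∀ i, MvPolynomial.aeval z (F i) = 0) → ∀ j, z j = (x j : ℂ)
  simple : (jacobianAt F x).det ≠ 0

/-- `p` is a point of `S` at minimal distance from `q`. -/
def IsNearestPoint {E : Type*} [Dist E] (S : Set E) (q p : E) : Prop :=
  p ∈ S ∧ ∀ p' ∈ S, dist q p ≤ dist q p'

/-- The point `(a, 0)` of `ℝⁿ⁺ᵏ`. -/
def zeroExtend {n : ℕ} (k : ℕ) (a : EuclideanSpace ℝ (Fin n)) :
    EuclideanSpace ℝ (Fin n ⊕ Fin k) :=
  WithLp.toLp 2 (Sum.elim (fun j => a j) (fun _ => 0))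

/-- The `x`-component of a point `(x, w)` of `ℝⁿ⁺ᵏ`. -/
def xPart {n k : ℕ} (p : EuclideanSpace ℝ (Fin n ⊕ Fin k)) : EuclideanSpace ℝ (Fin n) :=
  WithLp.toLp 2 (fun j => p (Sum.inl j))

/-- `S` is a smooth embedded submanifold of `E` of dimension `d`: around each of its points a
smooth local diffeomorphism of `E` straightens `S` to a linear subspace of dimension `d`. -/
def IsSmoothSubmanifold {E : Type*} [NormedAddCommGroup E] [NormedSpace ℝ E]
    (d : ℕ) (S : Set E) : Prop :=
  ∀ p ∈ S, ∃ (Φ : OpenPartialHomeomorph E E) (L : Submodule ℝ E),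
    p ∈ Φ.source ∧ ContDiffOn ℝ ∞ Φ Φ.source ∧ ContDiffOn ℝ ∞ Φ.symm Φ.target ∧
    Module.finrank ℝ L = d ∧ ∀ q ∈ Φ.source, q ∈ S ↔ Φ q ∈ L

/-- `γ` is continuous on `[s, t]` and of class `C^r` on each closed piece of a finite subdivision
of `[s, t]`. -/
def IsPiecewiseContDiffOn {E : Type*} [NormedAddCommGroup E] [NormedSpace ℝ E]
    (r : ℕ∞) (γ : ℝ → E) (s t : ℝ) : Prop :=
  ContinuousOn γ (Set.Icc s t) ∧
  ∃ (m : ℕ) (τ : Fin (m + 1) → ℝ), Monotone τ ∧ τ 0 = s ∧ τ (Fin.last m) = t ∧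
    ∀ i : Fin m, ContDiffOn ℝ r γ (Set.Icc (τ i.castSucc) (τ i.succ))

end CompanionCurve

end

/-! The zero set of `h` is the graph of `x ↦ -√β f(x)`, which a polynomial shear straightens. The
squared distance from `(a, 0)` to the graph point over `x` is `|x - a|² + β|f(x)|²`, and half its
gradient is `x + β Jᵗ f - a`. Nearest points therefore lie in fibres of the single map `G(x) = x + β
Jᵗ f`.

At a zero `v` of `f` the derivative of `G` is `1 + β JᵗJ`, which is positive definite, so `G` is
injective with nonsingular Jacobian on a ball of radius `δ` around `v`. If `a` is within `δ / 2` of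
`v`, comparison with `v` confines every nearest point to that ball. Injectivity then gives
uniqueness (`existsUnique_isNearestPoint`), and the inverse function theorem gives smooth dependence
on `a` (`exists_contDiffAt_nearestPoint`) and, applied over `ℂ`, isolation among complex zeros.
Uniqueness of the continued solution is unique lifting along `G`
(`eqOn_of_comp_eqOn_of_local_left_inverse`). -/

namespace CompanionCurve

open Topology Filter

/-! ### Derivatives and local inverses of polynomial maps over `ℝ` or `ℂ` -/

section PolynomialMaps

variable {𝕜 : Type*} [RCLike 𝕜] {σ : Type*} [Fintype σ]

theorem hasStrictFDerivAt_eval (p : MvPolynomial σ 𝕜) (z : σ → 𝕜) :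
    HasStrictFDerivAt (fun x : σ → 𝕜 => MvPolynomial.eval x p)
      (∑ j, MvPolynomial.eval z (MvPolynomial.pderiv j p) •
        ContinuousLinearMap.proj (R := 𝕜) (φ := fun _ : σ => 𝕜) j) z := by
  classical
  induction p using MvPolynomial.induction_on with
  | C a =>
    refine ((hasStrictFDerivAt_const a z).congr_of_eventuallyEq
      (.of_forall fun x => by simp)).congr_fderiv ?_
    ext v
    simp
  | add p q hp hq =>
    simp only [map_add]
    refine (hp.fun_add hq).congr_fderiv ?_
    ext v
    simp [add_mul, Finset.sum_add_distrib]
  | mul_X p i hp =>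
    simp only [map_mul, MvPolynomial.eval_X]
    have hi : HasStrictFDerivAt (fun x : σ → 𝕜 => x i)
        (ContinuousLinearMap.proj (R := 𝕜) (φ := fun _ : σ => 𝕜) i) z :=
      (ContinuousLinearMap.proj (R := 𝕜) (φ := fun _ : σ => 𝕜) i).hasStrictFDerivAt
    refine (hp.fun_mul hi).congr_fderiv ?_
    ext v
    simp [MvPolynomial.pderiv_X, Pi.single_apply, add_mul, Finset.sum_add_distrib, Finset.mul_sum,
      apply_ite, ite_mul, mul_assoc]

theorem contDiff_eval (p : MvPolynomial σ 𝕜) {r : WithTop ℕ∞} :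
    ContDiff 𝕜 r (fun x : σ → 𝕜 => MvPolynomial.eval x p) :=
  (AnalyticOnNhd.eval_mvPolynomial p).contDiff

variable [DecidableEq σ]

/-- Inverse function theorem for a square polynomial system with nonsingular Jacobian. -/
theorem exists_local_inverse (F : σ → MvPolynomial σ 𝕜) (z : σ → 𝕜)
    (hz : (Matrix.of fun i j => MvPolynomial.eval z (MvPolynomial.pderiv j (F i))).det ≠ 0) :
    ∃ X : (σ → 𝕜) → (σ → 𝕜),
      ContDiffAt 𝕜 ∞ X (fun i => MvPolynomial.eval z (F i)) ∧
      (∀ᶠ x in 𝓝 z, X (fun i => MvPolynomial.eval x (F i)) = x) ∧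
      ∀ᶠ y in 𝓝 (fun i => MvPolynomial.eval z (F i)),
        (fun i => MvPolynomial.eval (X y) (F i)) = y := by
  set M := Matrix.of fun i j => MvPolynomial.eval z (MvPolynomial.pderiv j (F i)) with hM
  set D : (σ → 𝕜) →L[𝕜] (σ → 𝕜) := LinearMap.toContinuousLinearMap (Matrix.toLin' M) with hD
  have hDdet : D.det ≠ 0 := by
    rw [hD]
    simpa [ContinuousLinearMap.det, LinearMap.det_toLin'] using hz
  set e := D.toContinuousLinearEquivOfDetNeZero hDdet with he
  have heD : (e : (σ → 𝕜) →L[𝕜] (σ → 𝕜)) = D :=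
    ContinuousLinearMap.coe_toContinuousLinearEquivOfDetNeZero D hDdet
  have hcd : ContDiffAt 𝕜 ∞ (fun x : σ → 𝕜 => fun i => MvPolynomial.eval x (F i)) z :=
    (contDiff_pi.2 fun i => contDiff_eval (F i)).contDiffAt
  have hst : HasStrictFDerivAt (fun x : σ → 𝕜 => fun i => MvPolynomial.eval x (F i))
      (e : (σ → 𝕜) →L[𝕜] (σ → 𝕜)) z := by
    rw [heD]
    refine hasStrictFDerivAt_pi'.2 fun i => (hasStrictFDerivAt_eval (F i) z).congr_fderiv ?_
    ext v
    simp [hD, hM, Matrix.mulVec, dotProduct]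
  refine ⟨hst.localInverse _ _ _, ?_, hst.eventually_left_inverse, hst.eventually_right_inverse⟩
  exact hcd.to_localInverse hst.hasFDerivAt (by simp)

end PolynomialMaps

variable {n k : ℕ}

/-! ### The slack system as a graph -/

/-- The point `(x, -√β f(x))` of the zero set of the slack system. -/
noncomputable def graphPoint (f : Fin k → MvPolynomial (Fin n) ℝ) (β : ℝ)
    (x : EuclideanSpace ℝ (Fin n)) : EuclideanSpace ℝ (Fin n ⊕ Fin k) :=
  WithLp.toLp 2 (Sum.elim (fun j => x j) (fun i => -(√β * MvPolynomial.eval (fun j => x j) (f i))))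

theorem eval_slackSystem (f : Fin k → MvPolynomial (Fin n) ℝ) (β : ℝ)
    (p : EuclideanSpace ℝ (Fin n ⊕ Fin k)) (i : Fin k) :
    MvPolynomial.eval (fun j => p j) (slackSystem f β i) =
      MvPolynomial.eval (fun j => xPart p j) (f i) + 1 / √β * p (Sum.inr i) := by
  simp [slackSystem, MvPolynomial.eval_rename, xPart, Function.comp_def]

theorem mem_realZeros_slackSystem (f : Fin k → MvPolynomial (Fin n) ℝ) {β : ℝ} (hβ : 0 < β)
    (p : EuclideanSpace ℝ (Fin n ⊕ Fin k)) :
    p ∈ realZeros (slackSystem f β) ↔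
      ∀ i, p (Sum.inr i) + √β * MvPolynomial.eval (fun j => xPart p j) (f i) = 0 := by
  have h : √β ≠ 0 := (Real.sqrt_pos.2 hβ).ne'
  refine forall_congr' fun i => ?_
  rw [eval_slackSystem]
  rw [show p (Sum.inr i) + √β * MvPolynomial.eval (fun j => xPart p j) (f i) =
    √β * (MvPolynomial.eval (fun j => xPart p j) (f i) + 1 / √β * p (Sum.inr i)) by
      field_simp; ring, mul_eq_zero, or_iff_right h]

theorem mem_realZeros_slackSystem_iff_eq_graphPoint (f : Fin k → MvPolynomial (Fin n) ℝ) {β : ℝ}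
    (hβ : 0 < β) (p : EuclideanSpace ℝ (Fin n ⊕ Fin k)) :
    p ∈ realZeros (slackSystem f β) ↔ p = graphPoint f β (xPart p) := by
  rw [mem_realZeros_slackSystem f hβ]
  constructor
  · intro h
    ext (j | i)
    · simp [graphPoint, xPart]
    · simpa [graphPoint] using eq_neg_of_add_eq_zero_left (h i)
  · intro h i
    conv_lhs => enter [1]; rw [h]
    simp [graphPoint]

@[simp]
theorem xPart_graphPoint (f : Fin k → MvPolynomial (Fin n) ℝ) (β : ℝ)
    (x : EuclideanSpace ℝ (Fin n)) : xPart (graphPoint f β x) = x := by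
  ext j
  simp [xPart, graphPoint]

theorem graphPoint_mem (f : Fin k → MvPolynomial (Fin n) ℝ) {β : ℝ} (hβ : 0 < β)
    (x : EuclideanSpace ℝ (Fin n)) : graphPoint f β x ∈ realZeros (slackSystem f β) := by
  rw [mem_realZeros_slackSystem_iff_eq_graphPoint f hβ, xPart_graphPoint]

theorem contDiff_eval_euclidean {σ : Type*} [Fintype σ] (p : MvPolynomial σ ℝ) {r : WithTop ℕ∞} :
    ContDiff ℝ r (fun x : EuclideanSpace ℝ σ => MvPolynomial.eval (fun j => x j) p) :=
  (contDiff_eval p).comp (EuclideanSpace.equiv σ ℝ).contDiff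

theorem contDiff_xPart {r : WithTop ℕ∞} :
    ContDiff ℝ r (xPart : EuclideanSpace ℝ (Fin n ⊕ Fin k) → EuclideanSpace ℝ (Fin n)) :=
  contDiff_euclidean.2 fun j => by
    simp only [xPart]
    fun_prop

theorem contDiff_graphPoint (f : Fin k → MvPolynomial (Fin n) ℝ) (β : ℝ) {r : WithTop ℕ∞} :
    ContDiff ℝ r (graphPoint f β) := by
  refine contDiff_euclidean.2 ?_
  rintro (j | i)
  · simp only [graphPoint, Sum.elim_inl]
    fun_prop
  · exact (contDiff_const.mul (contDiff_eval_euclidean (f i))).neg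

theorem isClosed_realZeros {σ ι : Type*} [Fintype σ] (f : ι → MvPolynomial σ ℝ) :
    IsClosed (realZeros f) := by
  simp only [realZeros, Set.ofPred_forall]
  exact isClosed_iInter fun i =>
    isClosed_eq (contDiff_eval_euclidean (f i) (r := 0)).continuous continuous_const

/-- The shear `(x, w) ↦ (x, w + c f(x))`. -/
noncomputable def shear (f : Fin k → MvPolynomial (Fin n) ℝ) (c : ℝ)
    (p : EuclideanSpace ℝ (Fin n ⊕ Fin k)) : EuclideanSpace ℝ (Fin n ⊕ Fin k) :=
  WithLp.toLp 2 (Sum.elim (fun j => p (Sum.inl j))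
    (fun i => p (Sum.inr i) + c * MvPolynomial.eval (fun j => xPart p j) (f i)))

theorem contDiff_shear (f : Fin k → MvPolynomial (Fin n) ℝ) (c : ℝ) {r : WithTop ℕ∞} :
    ContDiff ℝ r (shear f c) := by
  refine contDiff_euclidean.2 ?_
  rintro (j | i)
  · simp only [shear, Sum.elim_inl]
    fun_prop
  · simp only [shear, Sum.elim_inr]
    have h : ContDiff ℝ r fun p : EuclideanSpace ℝ (Fin n ⊕ Fin k) =>
        MvPolynomial.eval (fun j => xPart p j) (f i) :=
      (contDiff_eval_euclidean (f i)).comp contDiff_xPart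
    fun_prop

theorem shear_shear_of_add_eq_zero (f : Fin k → MvPolynomial (Fin n) ℝ) {c d : ℝ} (h : c + d = 0)
    (p : EuclideanSpace ℝ (Fin n ⊕ Fin k)) : shear f c (shear f d p) = p := by
  have hx : xPart (shear f d p) = xPart p := by
    ext j
    simp [xPart, shear]
  ext (j | i)
  · simp [shear]
  · have : shear f c (shear f d p) (Sum.inr i) = p (Sum.inr i) +
        d * MvPolynomial.eval (fun j => xPart p j) (f i) +
        c * MvPolynomial.eval (fun j => xPart (shear f d p) j) (f i) := rfl
    rw [this, hx]
    linear_combination MvPolynomial.eval (fun j => xPart p j) (f i) * h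

/-- The shear as a homeomorphism. -/
noncomputable def shearHomeomorph (f : Fin k → MvPolynomial (Fin n) ℝ) (c : ℝ) :
    EuclideanSpace ℝ (Fin n ⊕ Fin k) ≃ₜ EuclideanSpace ℝ (Fin n ⊕ Fin k) where
  toFun := shear f c
  invFun := shear f (-c)
  left_inv := shear_shear_of_add_eq_zero f (by ring)
  right_inv := shear_shear_of_add_eq_zero f (by ring)
  continuous_toFun := (contDiff_shear f c (r := 0)).continuous
  continuous_invFun := (contDiff_shear f (-c) (r := 0)).continuous

/-- The inclusion `x ↦ (x, 0)` as a linear map. -/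
noncomputable def zeroExtendLinear (n k : ℕ) :
    EuclideanSpace ℝ (Fin n) →ₗ[ℝ] EuclideanSpace ℝ (Fin n ⊕ Fin k) where
  toFun := zeroExtend k
  map_add' x y := by ext (j | i) <;> simp [zeroExtend]
  map_smul' c x := by ext (j | i) <;> simp [zeroExtend]

theorem zeroExtendLinear_injective : Function.Injective (zeroExtendLinear n k) := by
  intro x y h
  ext j
  exact congrArg (fun q : EuclideanSpace ℝ (Fin n ⊕ Fin k) => q (Sum.inl j)) h

theorem mem_range_zeroExtendLinear (q : EuclideanSpace ℝ (Fin n ⊕ Fin k)) :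
    q ∈ LinearMap.range (zeroExtendLinear n k) ↔ ∀ i, q (Sum.inr i) = 0 := by
  constructor
  · rintro ⟨x, rfl⟩ i
    rfl
  · intro h
    refine ⟨xPart q, ?_⟩
    ext (j | i)
    · rfl
    · exact (h i).symm

theorem isSmoothSubmanifold_slackSystem (f : Fin k → MvPolynomial (Fin n) ℝ) {β : ℝ}
    (hβ : 0 < β) : IsSmoothSubmanifold n (realZeros (slackSystem f β)) := by
  intro p _
  refine ⟨(shearHomeomorph f (√β)).toOpenPartialHomeomorph,
    LinearMap.range (zeroExtendLinear n k), trivial, (contDiff_shear f _).contDiffOn,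
    (contDiff_shear f _).contDiffOn, ?_, fun q _ => ?_⟩
  · rw [LinearMap.finrank_range_of_inj zeroExtendLinear_injective, finrank_euclideanSpace_fin]
  · rw [mem_range_zeroExtendLinear, mem_realZeros_slackSystem f hβ]
    rfl

/-! ### The squared distance to the graph -/

/-- The polynomial `|x - a|² + β |f(x)|²`. -/
noncomputable def penaltyObjective (f : Fin k → MvPolynomial (Fin n) ℝ) (β : ℝ)
    (a : EuclideanSpace ℝ (Fin n)) : MvPolynomial (Fin n) ℝ :=
  ∑ j, (MvPolynomial.X j - MvPolynomial.C (a j)) ^ 2 + MvPolynomial.C β * ∑ i, f i ^ 2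

theorem dist_zeroExtend_graphPoint_sq (f : Fin k → MvPolynomial (Fin n) ℝ) {β : ℝ} (hβ : 0 < β)
    (a x : EuclideanSpace ℝ (Fin n)) :
    dist (zeroExtend k a) (graphPoint f β x) ^ 2 =
      MvPolynomial.eval (fun j => x j) (penaltyObjective f β a) := by
  simp only [EuclideanSpace.dist_sq_eq, Fintype.sum_sum_type, penaltyObjective, zeroExtend,
    graphPoint, Sum.elim_inl, Sum.elim_inr, Real.dist_eq, sq_abs, map_add, map_sum, map_pow,
    map_sub, map_mul, MvPolynomial.eval_X, MvPolynomial.eval_C, Finset.mul_sum]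
  congr 1
  · exact Finset.sum_congr rfl fun j _ => by ring
  · exact Finset.sum_congr rfl fun i _ => by
      rw [zero_sub, neg_neg, mul_pow, Real.sq_sqrt hβ.le]

/-- This makes the square system the critical point equation of the squared distance. -/
theorem pderiv_penaltyObjective (f : Fin k → MvPolynomial (Fin n) ℝ) (β : ℝ)
    (a : EuclideanSpace ℝ (Fin n)) (j : Fin n) :
    MvPolynomial.pderiv j (penaltyObjective f β a) = 2 * penaltySystem f β a j := by
  have h : ∀ l : Fin n, MvPolynomial.pderiv j
      ((MvPolynomial.X l - MvPolynomial.C (a l) : MvPolynomial (Fin n) ℝ) ^ 2) =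
      if l = j then 2 * (MvPolynomial.X j - MvPolynomial.C (a j)) else 0 := by
    intro l
    rw [Derivation.leibniz_pow]
    by_cases hl : l = j
    · subst hl
      simp
    · simp [hl, MvPolynomial.pderiv_X_of_ne hl]
  simp only [penaltyObjective, penaltySystem, map_add, map_sum, MvPolynomial.pderiv_C_mul, h,
    Finset.sum_ite_eq', Finset.mem_univ, if_true, Derivation.leibniz_pow, smul_eq_mul]
  simp only [Finset.mul_sum, nsmul_eq_mul, mul_add, mul_sub]
  rw [add_sub_right_comm]
  congr 1
  refine Finset.sum_congr rfl fun i _ => ?_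
  push_cast
  ring

/-! ### The penalty map -/

/-- The map `x ↦ x + β Jᵗ f`. -/
noncomputable def penaltyMap (f : Fin k → MvPolynomial (Fin n) ℝ) (β : ℝ)
    (x : EuclideanSpace ℝ (Fin n)) : EuclideanSpace ℝ (Fin n) :=
  WithLp.toLp 2 fun j => MvPolynomial.eval (fun l => x l) (penaltySystem f β 0 j)

theorem mem_realZeros_penaltySystem (f : Fin k → MvPolynomial (Fin n) ℝ) (β : ℝ)
    (a x : EuclideanSpace ℝ (Fin n)) :
    x ∈ realZeros (penaltySystem f β a) ↔ penaltyMap f β x = a := by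
  rw [PiLp.ext_iff]
  refine forall_congr' fun j => ?_
  simp [penaltyMap, penaltySystem, sub_eq_zero]

theorem jacobianAt_penaltySystem (f : Fin k → MvPolynomial (Fin n) ℝ) (β : ℝ)
    (a x : EuclideanSpace ℝ (Fin n)) :
    jacobianAt (penaltySystem f β a) x = jacobianAt (penaltySystem f β 0) x := by
  ext i j
  simp [jacobianAt, penaltySystem]

theorem continuous_det_jacobianAt (F : Fin n → MvPolynomial (Fin n) ℝ) :
    Continuous fun x => (jacobianAt F x).det :=
  Continuous.matrix_det <| continuous_matrix fun _ _ =>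
    (contDiff_eval_euclidean _ (r := 0)).continuous

/-- Every second derivative of `f i` is multiplied by `f i`, which vanishes at `v`; what remains is
`1 + β JᵗJ`. -/
theorem det_jacobianAt_penaltySystem_ne_zero (f : Fin k → MvPolynomial (Fin n) ℝ) {β : ℝ}
    (hβ : 0 < β) (a : EuclideanSpace ℝ (Fin n)) {v : EuclideanSpace ℝ (Fin n)}
    (hv : v ∈ realZeros f) : (jacobianAt (penaltySystem f β a) v).det ≠ 0 := by
  have h : jacobianAt (penaltySystem f β a) v =
      1 + β • ((jacobianAt f v).conjTranspose * jacobianAt f v) := by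
    ext j l
    have hz : ∀ i, MvPolynomial.eval (fun j => v j) (f i) = 0 := hv
    simp only [jacobianAt, penaltySystem, Matrix.of_apply, map_sub, map_add,
      map_sum, MvPolynomial.pderiv_C, sub_zero,
      MvPolynomial.pderiv_mul, map_mul, hz, mul_zero, zero_add, Matrix.add_apply,
      Matrix.smul_apply, Matrix.mul_apply, Matrix.conjTranspose_apply, star_trivial, smul_eq_mul,
      MvPolynomial.pderiv_X, Matrix.one_apply, Pi.single_apply, map_zero]
    congr 1
    · split_ifs <;> simp_all
    · simp
  rw [h]
  exact (Matrix.PosDef.one.add_posSemidef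
    ((Matrix.posSemidef_conjTranspose_mul_self _).smul hβ.le)).det_pos.ne'

theorem exists_local_inverse_penaltyMap (f : Fin k → MvPolynomial (Fin n) ℝ) (β : ℝ)
    {x₀ : EuclideanSpace ℝ (Fin n)} (h : (jacobianAt (penaltySystem f β 0) x₀).det ≠ 0) :
    ∃ X : EuclideanSpace ℝ (Fin n) → EuclideanSpace ℝ (Fin n),
      ContDiffAt ℝ ∞ X (penaltyMap f β x₀) ∧
      (∀ᶠ x in 𝓝 x₀, X (penaltyMap f β x) = x) ∧
      ∀ᶠ y in 𝓝 (penaltyMap f β x₀), penaltyMap f β (X y) = y := by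
  obtain ⟨X, hX, hl, hr⟩ := exists_local_inverse (penaltySystem f β 0) (fun j => x₀ j) h
  let e := EuclideanSpace.equiv (Fin n) ℝ
  refine ⟨fun y => e.symm (X (e y)), ?_, ?_, ?_⟩
  · exact e.symm.contDiff.contDiffAt.comp _ (ContDiffAt.comp _ hX e.contDiff.contDiffAt)
  · filter_upwards [e.continuous.continuousAt.eventually hl] with x hx
    exact congrArg e.symm hx
  · filter_upwards [e.continuous.continuousAt.eventually hr] with y hy
    exact congrArg e.symm hy

theorem isIsolatedSimpleZero_penaltySystem (f : Fin k → MvPolynomial (Fin n) ℝ) (β : ℝ)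
    {a x : EuclideanSpace ℝ (Fin n)} (hx : penaltyMap f β x = a)
    (h : (jacobianAt (penaltySystem f β 0) x).det ≠ 0) :
    IsIsolatedSimpleZero (penaltySystem f β a) x := by
  refine ⟨(mem_realZeros_penaltySystem f β a x).2 hx, ?_, by rwa [jacobianAt_penaltySystem]⟩
  -- Evaluation at a real point commutes with extension of scalars, so the complex Jacobian
  -- determinant is the image of the real one.
  have hc : ∀ p : MvPolynomial (Fin n) ℝ,
      MvPolynomial.eval (fun j => (x j : ℂ)) (MvPolynomial.map (algebraMap ℝ ℂ) p) =
        (MvPolynomial.eval (fun j => x j) p : ℂ) := fun p => by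
    rw [MvPolynomial.eval_map]
    exact (MvPolynomial.eval₂_comp_left (algebraMap ℝ ℂ) (RingHom.id ℝ) (fun j => x j) p).symm
  have hdet : (Matrix.of fun i j => MvPolynomial.eval (fun j => (x j : ℂ)) (MvPolynomial.pderiv j
      (MvPolynomial.map (algebraMap ℝ ℂ) (penaltySystem f β a i)))).det ≠ 0 := by
    have hm : (Matrix.of fun i j => MvPolynomial.eval (fun j => (x j : ℂ)) (MvPolynomial.pderiv j
        (MvPolynomial.map (algebraMap ℝ ℂ) (penaltySystem f β a i)))) =
        (algebraMap ℝ ℂ).mapMatrix (jacobianAt (penaltySystem f β a) x) := by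
      ext i j
      simp only [Matrix.of_apply, MvPolynomial.pderiv_map, hc]
      rfl
    rw [hm, ← RingHom.map_det, jacobianAt_penaltySystem]
    simpa using h
  obtain ⟨X, -, hl, -⟩ := exists_local_inverse
    (fun i => MvPolynomial.map (algebraMap ℝ ℂ) (penaltySystem f β a i)) _ hdet
  obtain ⟨ε, hε, hball⟩ := Metric.eventually_nhds_iff.1 hl
  have hx0 : (fun i => MvPolynomial.eval (fun j => (x j : ℂ))
      (MvPolynomial.map (algebraMap ℝ ℂ) (penaltySystem f β a i))) = 0 := by
    ext i
    rw [hc, (mem_realZeros_penaltySystem f β a x).2 hx i]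
    simp
  refine ⟨ε, hε, fun z hz h0 j => ?_⟩
  have hz0 : (fun i => MvPolynomial.eval z
      (MvPolynomial.map (algebraMap ℝ ℂ) (penaltySystem f β a i))) = 0 := by
    ext i
    rw [MvPolynomial.eval_map, ← MvPolynomial.aeval_def, h0 i]
    rfl
  -- Both `z` and `x` are mapped to `0`, so the local left inverse returns each of them as its value
  -- at `0`.
  have h1 := hball (y := z) ((dist_pi_lt_iff hε).2 fun j => by rw [dist_eq_norm]; exact hz j)
  have h2 := hball (y := fun j => (x j : ℂ)) (by simpa using hε)
  rw [hz0] at h1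
  rw [hx0] at h2
  exact congrFun (h1.symm.trans h2) j

/-! ### Nearest points on the graph -/

theorem exists_isNearestPoint (f : Fin k → MvPolynomial (Fin n) ℝ) {β : ℝ} (hβ : 0 < β)
    (q : EuclideanSpace ℝ (Fin n ⊕ Fin k)) :
    ∃ p, IsNearestPoint (realZeros (slackSystem f β)) q p := by
  obtain ⟨p, hp, h⟩ := (isClosed_realZeros (slackSystem f β)).exists_infDist_eq_dist
    ⟨_, graphPoint_mem f hβ 0⟩ q
  exact ⟨p, hp, fun p' hp' => h ▸ Metric.infDist_le_dist_of_mem hp'⟩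

theorem IsNearestPoint.eq_graphPoint {f : Fin k → MvPolynomial (Fin n) ℝ} {β : ℝ} (hβ : 0 < β)
    {q p : EuclideanSpace ℝ (Fin n ⊕ Fin k)}
    (hp : IsNearestPoint (realZeros (slackSystem f β)) q p) : p = graphPoint f β (xPart p) :=
  (mem_realZeros_slackSystem_iff_eq_graphPoint f hβ p).1 hp.1

theorem IsNearestPoint.eval_penaltyObjective_le {f : Fin k → MvPolynomial (Fin n) ℝ} {β : ℝ}
    (hβ : 0 < β) {a : EuclideanSpace ℝ (Fin n)} {p : EuclideanSpace ℝ (Fin n ⊕ Fin k)}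
    (hp : IsNearestPoint (realZeros (slackSystem f β)) (zeroExtend k a) p)
    (x : EuclideanSpace ℝ (Fin n)) :
    MvPolynomial.eval (fun j => xPart p j) (penaltyObjective f β a) ≤
      MvPolynomial.eval (fun j => x j) (penaltyObjective f β a) := by
  rw [← dist_zeroExtend_graphPoint_sq f hβ, ← dist_zeroExtend_graphPoint_sq f hβ,
    ← hp.eq_graphPoint hβ]
  exact pow_le_pow_left₀ dist_nonneg (hp.2 _ (graphPoint_mem f hβ x)) 2

theorem IsNearestPoint.penaltyMap_xPart {f : Fin k → MvPolynomial (Fin n) ℝ} {β : ℝ}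
    (hβ : 0 < β) {a : EuclideanSpace ℝ (Fin n)} {p : EuclideanSpace ℝ (Fin n ⊕ Fin k)}
    (hp : IsNearestPoint (realZeros (slackSystem f β)) (zeroExtend k a) p) :
    penaltyMap f β (xPart p) = a := by
  rw [← mem_realZeros_penaltySystem]
  intro j
  have hmin : IsLocalMin (fun x : Fin n → ℝ => MvPolynomial.eval x (penaltyObjective f β a))
      (fun j => xPart p j) :=
    .of_forall fun x => hp.eval_penaltyObjective_le hβ (WithLp.toLp 2 x)
  have h0 := hmin.hasFDerivAt_eq_zero (hasStrictFDerivAt_eval _ _).hasFDerivAt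
  have hj := congrArg (fun D => D (Pi.single j 1)) h0
  simpa [pderiv_penaltyObjective, Pi.single_apply] using hj

theorem eval_penaltyObjective_eq (f : Fin k → MvPolynomial (Fin n) ℝ) (β : ℝ)
    (a x : EuclideanSpace ℝ (Fin n)) :
    MvPolynomial.eval (fun j => x j) (penaltyObjective f β a) =
      dist x a ^ 2 + β * ∑ i, MvPolynomial.eval (fun j => x j) (f i) ^ 2 := by
  simp [penaltyObjective, EuclideanSpace.dist_sq_eq, Real.dist_eq]

/-- At `v` the penalty term is zero, while at `xPart p` it is nonnegative and can be dropped. -/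
theorem IsNearestPoint.dist_xPart_le {f : Fin k → MvPolynomial (Fin n) ℝ} {β : ℝ}
    (hβ : 0 < β) {a v : EuclideanSpace ℝ (Fin n)} {p : EuclideanSpace ℝ (Fin n ⊕ Fin k)}
    (hp : IsNearestPoint (realZeros (slackSystem f β)) (zeroExtend k a) p)
    (hv : v ∈ realZeros f) : dist (xPart p) a ≤ dist v a := by
  have h := hp.eval_penaltyObjective_le hβ v
  have hz : ∀ i, MvPolynomial.eval (fun j => v j) (f i) = 0 := hv
  rw [eval_penaltyObjective_eq, eval_penaltyObjective_eq] at h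
  simp only [hz, ne_eq, OfNat.ofNat_ne_zero, not_false_eq_true, zero_pow, Finset.sum_const_zero,
    mul_zero, add_zero] at h
  refine le_of_sq_le_sq ?_ dist_nonneg
  refine le_trans (le_add_of_nonneg_right ?_) h
  exact mul_nonneg hβ.le (Finset.sum_nonneg fun i _ => sq_nonneg _)

/-! ### The neighbourhood of the zero set -/

/-- The points `a` within `δ / 2` of a zero `v` of `f` such that the penalty map is injective with
nonsingular Jacobian on the ball of radius `δ` around `v`. -/
def penaltyNhd (f : Fin k → MvPolynomial (Fin n) ℝ) (β : ℝ) : Set (EuclideanSpace ℝ (Fin n)) :=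
  {a | ∃ v ∈ realZeros f, ∃ δ > 0, dist a v < δ / 2 ∧
    Set.InjOn (penaltyMap f β) (Metric.ball v δ) ∧
    ∀ x ∈ Metric.ball v δ, (jacobianAt (penaltySystem f β 0) x).det ≠ 0}

theorem isOpen_penaltyNhd (f : Fin k → MvPolynomial (Fin n) ℝ) (β : ℝ) :
    IsOpen (penaltyNhd f β) := by
  refine isOpen_iff_mem_nhds.2 ?_
  rintro a ⟨v, hv, δ, hδ, hav, h⟩
  filter_upwards [Metric.isOpen_ball.mem_nhds (show a ∈ Metric.ball v (δ / 2) from hav)] with b hb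
  exact ⟨v, hv, δ, hδ, hb, h⟩

theorem realZeros_subset_penaltyNhd (f : Fin k → MvPolynomial (Fin n) ℝ) {β : ℝ} (hβ : 0 < β) :
    realZeros f ⊆ penaltyNhd f β := by
  intro v hv
  have hdet := det_jacobianAt_penaltySystem_ne_zero f hβ 0 hv
  obtain ⟨X, -, hl, -⟩ := exists_local_inverse_penaltyMap f β hdet
  have hne := (continuous_det_jacobianAt (penaltySystem f β 0)).continuousAt.eventually_ne hdet
  -- One radius serves both the left inverse, which yields injectivity, and the determinant.
  obtain ⟨δ, hδ, hball⟩ := Metric.eventually_nhds_iff_ball.1 (hl.and hne)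
  refine ⟨v, hv, δ, hδ, by simpa using hδ, ?_, fun x hx => (hball x hx).2⟩
  intro x hx y hy hxy
  rw [← (hball x hx).1, ← (hball y hy).1, hxy]

/-- Both `xPart p` and `v` are less than `δ / 2` from `a`; this is why `penaltyNhd` halves the
radius. -/
theorem IsNearestPoint.xPart_mem_ball {f : Fin k → MvPolynomial (Fin n) ℝ} {β : ℝ}
    (hβ : 0 < β) {a v : EuclideanSpace ℝ (Fin n)} {p : EuclideanSpace ℝ (Fin n ⊕ Fin k)}
    (hp : IsNearestPoint (realZeros (slackSystem f β)) (zeroExtend k a) p)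
    (hv : v ∈ realZeros f) {δ : ℝ} (ha : dist a v < δ / 2) : xPart p ∈ Metric.ball v δ := by
  rw [Metric.mem_ball]
  linarith [dist_triangle (xPart p) a v, hp.dist_xPart_le hβ hv, dist_comm v a]

theorem IsNearestPoint.det_jacobianAt_ne_zero {f : Fin k → MvPolynomial (Fin n) ℝ} {β : ℝ}
    (hβ : 0 < β) {a : EuclideanSpace ℝ (Fin n)} (ha : a ∈ penaltyNhd f β)
    {p : EuclideanSpace ℝ (Fin n ⊕ Fin k)}
    (hp : IsNearestPoint (realZeros (slackSystem f β)) (zeroExtend k a) p) :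
    (jacobianAt (penaltySystem f β 0) (xPart p)).det ≠ 0 := by
  obtain ⟨v, hv, δ, -, hav, -, hdet⟩ := ha
  exact hdet _ (hp.xPart_mem_ball hβ hv hav)

theorem existsUnique_isNearestPoint (f : Fin k → MvPolynomial (Fin n) ℝ) {β : ℝ} (hβ : 0 < β)
    {a : EuclideanSpace ℝ (Fin n)} (ha : a ∈ penaltyNhd f β) :
    ∃! p, IsNearestPoint (realZeros (slackSystem f β)) (zeroExtend k a) p := by
  obtain ⟨v, hv, δ, -, hav, hinj, -⟩ := ha
  refine existsUnique_of_exists_of_unique (exists_isNearestPoint f hβ _) fun p q hp hq => ?_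
  rw [hp.eq_graphPoint hβ, hq.eq_graphPoint hβ,
    hinj (hp.xPart_mem_ball hβ hv hav) (hq.xPart_mem_ball hβ hv hav)
      ((hp.penaltyMap_xPart hβ).trans (hq.penaltyMap_xPart hβ).symm)]

/-- Near a point of `penaltyNhd f β`, the nearest point depends smoothly on `a`. -/
theorem exists_contDiffAt_nearestPoint (f : Fin k → MvPolynomial (Fin n) ℝ) {β : ℝ} (hβ : 0 < β)
    {a : EuclideanSpace ℝ (Fin n)} (ha : a ∈ penaltyNhd f β) :
    ∃ P : EuclideanSpace ℝ (Fin n) → EuclideanSpace ℝ (Fin n ⊕ Fin k),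
      ContDiffAt ℝ ∞ P a ∧ ∀ᶠ b in 𝓝 a, ∀ p,
        IsNearestPoint (realZeros (slackSystem f β)) (zeroExtend k b) p → p = P b := by
  obtain ⟨p₀, hp₀⟩ := exists_isNearestPoint f hβ (zeroExtend k a)
  obtain ⟨X, hX, hl, hr⟩ :=
    exists_local_inverse_penaltyMap f β (hp₀.det_jacobianAt_ne_zero hβ ha)
  have hX₀ := hl.self_of_nhds
  rw [hp₀.penaltyMap_xPart hβ] at hX hr hX₀
  obtain ⟨v, hv, δ, -, hav, hinj, -⟩ := ha
  refine ⟨graphPoint f β ∘ X, (contDiff_graphPoint f β).contDiffAt.comp a hX, ?_⟩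
  -- The local branch `X` stays in the ball where the penalty map is injective, so it must coincide
  -- with the nearest point.
  have hXball : ∀ᶠ b in 𝓝 a, X b ∈ Metric.ball v δ :=
    hX.continuousAt.eventually_mem (Metric.isOpen_ball.mem_nhds
      (hX₀ ▸ hp₀.xPart_mem_ball hβ hv hav))
  filter_upwards [hr, hXball,
    Metric.isOpen_ball.mem_nhds (show a ∈ Metric.ball v (δ / 2) from hav)] with b hb hbX hbv p hp
  rw [hp.eq_graphPoint hβ, Function.comp_apply,
    hinj (hp.xPart_mem_ball hβ hv hbv) hbX ((hp.penaltyMap_xPart hβ).trans hb.symm)]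

/-! ### Curves -/

/-- On `S` near `u`, `p` is a smooth map composed with `γ`. Leaving `S` and `r` free covers both
continuity on `[s, t]` (`r = 0`) and regularity on each closed piece. -/
theorem contDiffWithinAt_nearestPoint {f : Fin k → MvPolynomial (Fin n) ℝ} {β : ℝ} (hβ : 0 < β)
    {r : WithTop ℕ∞} (hr : r ≤ ∞) {γ : ℝ → EuclideanSpace ℝ (Fin n)}
    {p : ℝ → EuclideanSpace ℝ (Fin n ⊕ Fin k)} {S : Set ℝ} {u : ℝ} (hu : u ∈ S)
    (hγ : ContDiffWithinAt ℝ r γ S u) (hγU : γ u ∈ penaltyNhd f β)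
    (hp : ∀ u ∈ S, IsNearestPoint (realZeros (slackSystem f β)) (zeroExtend k (γ u)) (p u)) :
    ContDiffWithinAt ℝ r p S u := by
  obtain ⟨P, hP, hev⟩ := exists_contDiffAt_nearestPoint f hβ hγU
  refine ((hP.of_le hr).comp_contDiffWithinAt u hγ).congr_of_eventuallyEq_of_mem ?_ hu
  filter_upwards [hγ.continuousWithinAt.eventually hev, self_mem_nhdsWithin] with w hw hwS
  exact hw _ (hp w hwS)

theorem isPiecewiseContDiffOn_nearestPoint {f : Fin k → MvPolynomial (Fin n) ℝ} {β : ℝ}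
    (hβ : 0 < β) {r : ℕ∞} {s t : ℝ} {γ : ℝ → EuclideanSpace ℝ (Fin n)}
    {p : ℝ → EuclideanSpace ℝ (Fin n ⊕ Fin k)} (hγ : IsPiecewiseContDiffOn r γ s t)
    (hγU : ∀ u ∈ Set.Icc s t, γ u ∈ penaltyNhd f β)
    (hp : ∀ u ∈ Set.Icc s t,
      IsNearestPoint (realZeros (slackSystem f β)) (zeroExtend k (γ u)) (p u)) :
    IsPiecewiseContDiffOn r p s t := by
  obtain ⟨hcont, m, τ, hτ, h0, h1, hpieces⟩ := hγ
  refine ⟨contDiffOn_zero.1 fun u hu => contDiffWithinAt_nearestPoint hβ (by simp) hu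
    (contDiffOn_zero.2 hcont u hu) (hγU u hu) hp, m, τ, hτ, h0, h1, fun i => ?_⟩
  have hsub : Set.Icc (τ i.castSucc) (τ i.succ) ⊆ Set.Icc s t :=
    Set.Icc_subset_Icc (h0 ▸ hτ (Fin.zero_le _)) (h1 ▸ hτ (Fin.le_last _))
  exact fun u hu => contDiffWithinAt_nearestPoint hβ (by exact_mod_cast le_top) hu
    (hpieces i u hu) (hγU u (hsub hu)) fun w hw => hp w (hsub hw)

/-- Two continuous lifts of the same map along a map `G` that is locally injective along one of
them agree on a preconnected set once they agree at one point. -/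
theorem eqOn_of_comp_eqOn_of_local_left_inverse {A E F : Type*} [TopologicalSpace A]
    [TopologicalSpace E] [T2Space E] {G : E → F} {S : Set A} (hS : IsPreconnected S)
    {x y : A → E} (hx : ContinuousOn x S) (hy : ContinuousOn y S)
    (hG : ∀ u ∈ S, G (y u) = G (x u))
    (hinv : ∀ u ∈ S, ∃ X : F → E, ∀ᶠ z in 𝓝 (x u), X (G z) = z)
    {u₀ : A} (hu₀ : u₀ ∈ S) (h₀ : y u₀ = x u₀) : ∀ u ∈ S, y u = x u := by
  have : PreconnectedSpace S := Subtype.preconnectedSpace hS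
  have hx' := continuousOn_iff_continuous_domRestrict.1 hx
  have hy' := continuousOn_iff_continuous_domRestrict.1 hy
  have hclosed : IsClosed {u : S | S.domRestrict y u = S.domRestrict x u} := isClosed_eq hy' hx'
  -- Where the lifts agree, both stay nearby in the region on which `X` inverts `G`, and their
  -- images under `G` are equal.
  have hopen : IsOpen {u : S | S.domRestrict y u = S.domRestrict x u} := by
    refine isOpen_iff_mem_nhds.2 fun u hu => ?_
    obtain ⟨X, hX⟩ := hinv u u.2
    have hu' : S.domRestrict y u = x u := hu
    have hXy : ∀ᶠ z in 𝓝 (S.domRestrict y u), X (G z) = z := hu' ▸ hX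
    filter_upwards [hx'.continuousAt.eventually hX, hy'.continuousAt.eventually hXy] with w hwx hwy
    show S.domRestrict y w = S.domRestrict x w
    rw [← hwx, ← hwy]
    exact congrArg X (hG w w.2)
  have huniv := IsClopen.eq_univ ⟨hclosed, hopen⟩ ⟨⟨u₀, hu₀⟩, h₀⟩
  intro u hu
  exact (Set.eq_univ_iff_forall.1 huniv) ⟨u, hu⟩

end CompanionCurve

theorem mainTheorem1 (n k : ℕ) (f : Fin k → MvPolynomial (Fin n) ℝ)
    (hf : (CompanionCurve.realZeros f).Nonempty) (β : ℝ) (hβ : 0 < β) :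
    CompanionCurve.IsSmoothSubmanifold n
      (CompanionCurve.realZeros (CompanionCurve.slackSystem f β)) ∧
    ∃ U : Set (EuclideanSpace ℝ (Fin n)),
      IsOpen U ∧ CompanionCurve.realZeros f ⊆ U ∧
      -- every `(a, 0)` with `a ∈ U` has a unique nearest point on `V_ℝ(h)`,
      (∀ a ∈ U, ∃! p, CompanionCurve.IsNearestPoint
        (CompanionCurve.realZeros (CompanionCurve.slackSystem f β))
        (CompanionCurve.zeroExtend k a) p) ∧
      -- whose `x`-component is an isolated simple zero of `x + β Jᵗ f = a`;
      (∀ a ∈ U, ∀ p, CompanionCurve.IsNearestPoint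
        (CompanionCurve.realZeros (CompanionCurve.slackSystem f β))
        (CompanionCurve.zeroExtend k a) p →
        CompanionCurve.IsIsolatedSimpleZero (CompanionCurve.penaltySystem f β a)
          (CompanionCurve.xPart p)) ∧
      -- along a piecewise smooth curve in `U` the projection trajectory is piecewise smooth, and
      -- it is the only continuous solution of the equation from any of its points.
      (∀ (r : ℕ∞) (s t : ℝ) (γ : ℝ → EuclideanSpace ℝ (Fin n)), 1 ≤ r → s ≤ t →
        CompanionCurve.IsPiecewiseContDiffOn r γ s t → (∀ u ∈ Set.Icc s t, γ u ∈ U) →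
        ∀ p : ℝ → EuclideanSpace ℝ (Fin n ⊕ Fin k),
          (∀ u ∈ Set.Icc s t, CompanionCurve.IsNearestPoint
            (CompanionCurve.realZeros (CompanionCurve.slackSystem f β))
            (CompanionCurve.zeroExtend k (γ u)) (p u)) →
          CompanionCurve.IsPiecewiseContDiffOn r p s t ∧
          ∀ u₀ ∈ Set.Icc s t, ∀ y : ℝ → EuclideanSpace ℝ (Fin n),
            ContinuousOn y (Set.Icc s t) →
            (∀ u ∈ Set.Icc s t,
              y u ∈ CompanionCurve.realZeros (CompanionCurve.penaltySystem f β (γ u))) →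
            y u₀ = CompanionCurve.xPart (p u₀) →
            ∀ u ∈ Set.Icc s t, y u = CompanionCurve.xPart (p u)) := by

  open CompanionCurve in
  refine ⟨isSmoothSubmanifold_slackSystem f hβ, penaltyNhd f β, isOpen_penaltyNhd f β,
    realZeros_subset_penaltyNhd f hβ, fun a ha => existsUnique_isNearestPoint f hβ ha,
    fun a ha p hp => isIsolatedSimpleZero_penaltySystem f β (hp.penaltyMap_xPart hβ)
      (hp.det_jacobianAt_ne_zero hβ ha), ?_⟩
  intro r s t γ _ _ hγ hγU p hp
  have hpc := CompanionCurve.isPiecewiseContDiffOn_nearestPoint hβ hγ hγU hp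
  refine ⟨hpc, fun u₀ hu₀ y hy hyz h₀ => ?_⟩
  -- Local inverses are needed only along `x`: nothing is assumed about where `y` travels.
  refine CompanionCurve.eqOn_of_comp_eqOn_of_local_left_inverse
    (G := CompanionCurve.penaltyMap f β) (x := fun u => CompanionCurve.xPart (p u))
    isPreconnected_Icc
    ((CompanionCurve.contDiff_xPart (r := 0)).continuous.comp_continuousOn hpc.1) hy
    (fun u hu => ?_) (fun u hu => ?_) hu₀ h₀
  · rw [(hp u hu).penaltyMap_xPart hβ]
    exact (CompanionCurve.mem_realZeros_penaltySystem f β _ _).1 (hyz u hu)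
  · obtain ⟨X, -, hl, -⟩ := CompanionCurve.exists_local_inverse_penaltyMap f β
      ((hp u hu).det_jacobianAt_ne_zero hβ (hγU u hu))
    exact ⟨X, hl⟩
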